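/- Let $(R,\mathfrak m)$ be a Noetherian one-dimensional local domain with $\operatorname{char}(R)\neq 2$ and field of fractions $Q(R)$. Assume that $R$ is analytically irreducible (its $\mathfrak m$-adic completion is a domain) and residually rational (the integral closure $\overline R$ of $R$ in $Q(R)$ is local, and the canonical map from the residue field of $R$ to that of $\overline R$ is an isomorphism). Let $v:Q(R)\to\mathbb Z\cup\{\infty\}$ be the normalized discrete valuation with valuation ring $\overline R$. Let $I$ be an ideal of $R$, let $R[It]=\bigoplus_{n\ge 0}I^nt^n\subseteq R[t]$ be its Rees algebra, let $b\in R$ be such that $m=v(b)$ is an odd integer, and put \[\mathcal R=\frac{R[It]}{(t^2-b)R[t]\cap R[It]},\qquad Q(R)[\alpha]=Q(R)[t]/(t^2-b),\] where $\alpha$ is the class of $t$. Then $\mathcal R$ is a Noetherian one-dimensional local domain which is analytically irreducible and residually rational. The ring $Q(R)[\alpha]$ is a field, the natural map $\mathcal R\to Q(R)[\alpha]$ is injective, and if $I\neq 0$ then $Q(R)[\alpha]$ is the field of fractions of $\mathcal R$. The integral closure of $\mathcal R$ in $Q(R)[\alpha]$ is the valuation ring of a normalized discrete valuation $v':Q(R)[\alpha]\to\mathbb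 Z\cup\{\infty\}$, and every such $v'$ satisfies $v'|_{Q(R)}=2v$, $v'(\alpha)=m$ and \[v'(\mathcal R)=v(R)\Join^{m}v(I):=2\cdot v(R)\,\cup\,\bigl(2\cdot v(I)+m\bigr),\] where, for a subset $T$ of the respective field, $v(T)$ and $v'(T)$ denote the sets of values of the nonzero elements of $T$, and $2\cdot A=\{2a:a\in A\}$. -/

import Mathlib

open Polynomial

noncomputable section

/-- A local ring `A` is analytically irreducible if its completion with respect to its maximal
ideal is a domain. -/
def IsAnalyticallyIrreducible (A : Type*) [CommRing A] [IsLocalRing A] : Prop :=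
  IsDomain (AdicCompletion (IsLocalRing.maximalIdeal A) A)

/-- A local domain `A` is residually rational if its integral closure in its field of fractions
is local, dominates `A`, and the canonical map of residue fields is an isomorphism. -/
def IsResiduallyRational (A : Type*) [CommRing A] [IsLocalRing A] : Prop :=
  ∃ (_ : IsLocalRing (integralClosure A (FractionRing A)))
    (_ : IsLocalHom (algebraMap A (integralClosure A (FractionRing A)))),
    Function.Bijective
      (IsLocalRing.ResidueField.map (algebraMap A (integralClosure A (FractionRing A))))

/-- For a field `F` and a subring `A` (or its image in `F`), `v` is the normalized discrete
valuation `F → ℤ ∪ {∞}` whose valuation ring is the integral closure of `A` in `F`. -/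
def IsNormalizedValuationOf (A : Type*) {F : Type*} [CommRing A] [CommRing F] [Algebra A F]
    (v : AddValuation F (WithTop ℤ)) : Prop :=
  (∀ x : F, 0 ≤ v x ↔ x ∈ integralClosure A F) ∧ ∃ x : F, v x = 1

/-- The set of finite values of `v` on a set `T`, that is `{v x | x ∈ T, x ≠ 0}` when `F` is a
field. -/
def valueSet {F : Type*} [CommRing F] (v : AddValuation F (WithTop ℤ)) (T : Set F) : Set ℤ :=
  {n : ℤ | ∃ x ∈ T, v x = (n : WithTop ℤ)}

/-- The numerical duplication `2 · S ∪ (2 · E + m)`. -/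
def numericalDuplication (S E : Set ℤ) (m : ℤ) : Set ℤ :=
  (fun s : ℤ => 2 * s) '' S ∪ (fun e : ℤ => 2 * e + m) '' E

variable {R : Type*} [CommRing R]

/-- The ideal `(t² - b) ∩ R[It]` of the Rees algebra `R[It]`. -/
def reesQuadraticIdeal (I : Ideal R) (b : R) : Ideal (reesAlgebra I) :=
  (Ideal.span {(X ^ 2 - C b : R[X])}).comap (reesAlgebra I).val

/-- The ring `R[It] / ((t² - b) ∩ R[It])`. -/
def ReesQuotient (I : Ideal R) (b : R) : Type _ :=
  reesAlgebra I ⧸ reesQuadraticIdeal I b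

instance (I : Ideal R) (b : R) : CommRing (ReesQuotient I b) :=
  inferInstanceAs (CommRing (reesAlgebra I ⧸ reesQuadraticIdeal I b))

/-- The quotient map `R[It] → R[It] / ((t² - b) ∩ R[It])`. -/
def ReesQuotient.mk (I : Ideal R) (b : R) : reesAlgebra I →+* ReesQuotient I b :=
  Ideal.Quotient.mk (reesQuadraticIdeal I b)

/-- The ring `Q(R)[α] = Q(R)[t] / (t² - b)`, where `α = AdjoinRoot.root _` is the class of `t`. -/
abbrev QuadraticExtension (b : R) : Type _ :=
  AdjoinRoot (X ^ 2 - C (algebraMap R (FractionRing R) b) : (FractionRing R)[X])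

/-- The map `R[t] → Q(R)[α]` extending `R → Q(R)` and sending `t` to `α`. -/
def polynomialToQuadraticExtension (b : R) : R[X] →+* QuadraticExtension b :=
  (AdjoinRoot.mk _).comp (mapRingHom (algebraMap R (FractionRing R)))

/-- The natural map `R[It] / ((t² - b) ∩ R[It]) → Q(R)[α]` sending the class of `p(t)` to
`p(α)`. -/
def reesQuotientToQuadraticExtension (I : Ideal R) (b : R) :
    ReesQuotient I b →+* QuadraticExtension b :=
  Ideal.Quotient.lift (reesQuadraticIdeal I b)
    ((polynomialToQuadraticExtension b).comp (reesAlgebra I).val.toRingHom) (by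
      intro p hp
      obtain ⟨q, hq⟩ := Ideal.mem_span_singleton.mp (Ideal.mem_comap.mp hp)
      have h : polynomialToQuadraticExtension b (X ^ 2 - C b) = 0 := by
        simp [polynomialToQuadraticExtension, AdjoinRoot.mk_self]
      change polynomialToQuadraticExtension b ((reesAlgebra I).val p) = 0
      rw [hq, map_mul, h, zero_mul])

instance (I : Ideal R) (b : R) : Algebra (ReesQuotient I b) (QuadraticExtension b) :=
  (reesQuotientToQuadraticExtension I b).toAlgebra

end

/-! Since α² = b, even powers of t contribute elements of R and odd powers elements of Iα, because
I^(2n+1) ⊆ I. So each element of the quotient is uniquely r + iα with r ∈ R and i ∈ I. The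
conjugation identity (r + iα)(r - iα) = r² - bi² brings questions about units and dimension back to
R.

The valuation is v'(x + yα) = v(x² - by²), the value of the norm. As m is odd, v(x²) and v(by²) have
different parities, so v'(x + yα) = min(2v(x), 2v(y) + m). This formula (`valuation_elt`) yields the
ultrametric inequality, the value set, the description of the integral closure and the equality of
residue fields. The parity computation also shows that b is not a square, so Q(R)[α] is a field. A
normalized valuation is determined by its valuation ring (`AddValuation.eq_of_nonneg_iff`), so the
statements about every v' reduce to this one.

Analytic irreducibility is transferred by comparing topologies. If every power of the maximal ideal
contains a valuation ideal {u ≥ k}, the completion is a domain. Conversely, in R the limits of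
sequences whose values tend to infinity form a prime of the completion that meets R only in 0. The
completion is a Noetherian domain of dimension at most one, so this prime is zero; a Chevalley-type
argument would make it nonzero if some power of the maximal ideal contained no valuation ideal.
Artin-Rees carries the topology from R to the summand Iα. -/

open IsLocalRing

/-! ### Complete local rings: Noetherianity and primes in dimension one -/

/-- Finitely generated ideals `N` of a `J`-adically complete ring are closed: if `P ⊆ N + aP` with
`a ∈ J`, then `P ⊆ N`. -/
theorem Ideal.le_of_le_sup_span_mul {B : Type*} [CommRing B] {J : Ideal B} [IsAdicComplete J B]
    {a : B} (ha : a ∈ J) {N P : Ideal B} (hN : N.FG) (h : P ≤ N ⊔ Ideal.span {a} * P) :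
    P ≤ N := by
  obtain ⟨s, p, rfl⟩ := Submodule.fg_iff_exists_fin_generating_family.mp hN
  intro x hx
  have step : ∀ y : P, ∃ z : P, ∃ c : Fin s → B, (y : B) = ∑ i, c i * p i + a * z := by
    intro y
    obtain ⟨u, hu, t, ht, hut⟩ := Submodule.mem_sup.mp (h y.2)
    obtain ⟨c, rfl⟩ := (Submodule.mem_span_range_iff_exists_fun B).mp hu
    obtain ⟨z, hz, rfl⟩ := Ideal.mem_span_singleton_mul.mp ht
    exact ⟨⟨z, hz⟩, c, by simpa using hut.symm⟩
  choose nxt c hc using step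
  let y : ℕ → P := fun n => nxt^[n] ⟨x, hx⟩
  have hy : ∀ n, y (n + 1) = nxt (y n) := fun n => Function.iterate_succ_apply' nxt n _
  -- Iterating the decomposition gives coefficients that are partial sums of power series in a;
  -- completeness supplies their limits, and separatedness kills the remainder.
  have hsum : ∀ n, x = ∑ i, (∑ j ∈ Finset.range n, a ^ j * c (y j) i) * p i + a ^ n * y n := by
    intro n
    induction n with
    | zero => simp [y]
    | succ n ih =>
      rw [hy, ih, hc (y n)]
      simp only [Finset.sum_range_succ, add_mul, Finset.sum_add_distrib, mul_add, Finset.mul_sum]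
      rw [pow_succ]
      simp only [mul_assoc, add_assoc]
  have hlim : ∀ i, ∃ C : B, ∀ n, C - ∑ j ∈ Finset.range n, a ^ j * c (y j) i ∈ J ^ n := by
    intro i
    obtain ⟨C, hC⟩ := IsPrecomplete.prec (I := J) (M := B) inferInstance
      (f := fun n => ∑ j ∈ Finset.range n, a ^ j * c (y j) i) (by
        intro m n hmn
        rw [SModEq.sub_mem, ← neg_mem_iff, neg_sub, Finset.sum_range_sub_sum_range hmn]
        refine Submodule.sum_mem _ fun j hj => ?_
        simp only [smul_eq_mul, Ideal.mul_top]
        exact Ideal.mul_mem_right _ _ (Ideal.pow_le_pow_right (Finset.mem_filter.mp hj).2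
          (Ideal.pow_mem_pow ha j)))
    refine ⟨C, fun n => ?_⟩
    have := (SModEq.sub_mem.mp (hC n).symm)
    simpa using this
  choose C hC using hlim
  have hx0 : x - ∑ i, C i * p i = 0 := by
    refine IsHausdorff.haus (I := J) inferInstance _ fun n => ?_
    rw [SModEq.zero]
    simp only [smul_eq_mul, Ideal.mul_top]
    have : x - ∑ i, C i * p i =
        a ^ n * y n - ∑ i, (C i - ∑ j ∈ Finset.range n, a ^ j * c (y j) i) * p i := by
      simp only [sub_mul, Finset.sum_sub_distrib]
      linear_combination hsum n
    rw [this]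
    exact sub_mem (Ideal.mul_mem_right _ _ (Ideal.pow_mem_pow ha n))
      (Submodule.sum_mem _ fun i _ => Ideal.mul_mem_right _ _ (hC i n))
  rw [sub_eq_zero.mp hx0]
  exact Submodule.sum_mem _ fun i _ => Ideal.mul_mem_left _ _ (Submodule.subset_span ⟨i, rfl⟩)

theorem IsLocalRing.eq_maximalIdeal_of_le_radical {B : Type*} [CommRing B] [IsLocalRing B]
    {a : B} (h : maximalIdeal B ≤ (Ideal.span {a}).radical) {P : Ideal B} (hP : P.IsPrime)
    (haP : a ∈ P) : P = maximalIdeal B :=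
  le_antisymm (le_maximalIdeal hP.ne_top)
    (h.trans (hP.radical_le_iff.mpr ((Ideal.span_singleton_le_iff_mem _).mpr haP)))

/-- By Cohen's theorem only primes matter. A prime containing a is maximal. If a ∉ P, then P ∩ aB =
aP, so lifts to P of generators of its image modulo a generate P up to aP, hence generate P by
completeness. -/
theorem IsNoetherianRing.of_isAdicComplete_maximalIdeal {B : Type*} [CommRing B] [IsLocalRing B]
    (hfg : (maximalIdeal B).FG) [IsAdicComplete (maximalIdeal B) B] {a : B}
    (ha : a ∈ maximalIdeal B) (h : maximalIdeal B ≤ (Ideal.span {a}).radical) :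
    IsNoetherianRing B := by
  have hq : IsNoetherianRing (B ⧸ Ideal.span {a}) := by
    refine IsNoetherianRing.of_prime fun Q hQ => ?_
    have hcomap := IsLocalRing.eq_maximalIdeal_of_le_radical h
      (hQ.comap (Ideal.Quotient.mk (Ideal.span {a}))) (by
        rw [Ideal.mem_comap, Ideal.Quotient.eq_zero_iff_mem.mpr (Ideal.mem_span_singleton_self a)]
        exact zero_mem _)
    rw [← Ideal.map_comap_of_surjective _ Ideal.Quotient.mk_surjective Q, hcomap]
    exact hfg.map _
  refine IsNoetherianRing.of_prime fun P hP => ?_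
  by_cases haP : a ∈ P
  · rwa [IsLocalRing.eq_maximalIdeal_of_le_radical h hP haP]
  · have hfgP : (P.map (Ideal.Quotient.mk (Ideal.span {a}))).FG := hq.noetherian _
    obtain ⟨N, hNP, hN, hmap⟩ : ∃ N ≤ P, N.FG ∧ N.map (Ideal.Quotient.mk (Ideal.span {a})) =
        P.map (Ideal.Quotient.mk (Ideal.span {a})) := by
      classical
      obtain ⟨t, ht, hspan⟩ := (Submodule.fg_span_iff_fg_span_finset_subset _).mp hfgP
      obtain ⟨t', ht', rfl⟩ := Finset.subset_set_image_iff.mp ht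
      refine ⟨Ideal.span t', Ideal.span_le.mpr ht', ⟨t', rfl⟩, ?_⟩
      rw [Ideal.map_span, ← Finset.coe_image]
      exact hspan.symm
    have hle : P ≤ N ⊔ Ideal.span {a} * P := by
      intro x hx
      have hx' := Ideal.mem_map_of_mem (Ideal.Quotient.mk (Ideal.span {a})) hx
      rw [← hmap, Ideal.mem_map_iff_of_surjective _ Ideal.Quotient.mk_surjective] at hx'
      obtain ⟨n, hn, hnx⟩ := hx'
      rw [Ideal.Quotient.mk_eq_mk_iff_sub_mem, Ideal.mem_span_singleton] at hnx
      obtain ⟨z, hz⟩ := hnx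
      have hzP : z ∈ P := by
        refine (hP.mem_or_mem (?_ : a * z ∈ P)).resolve_left haP
        rw [← hz]
        exact sub_mem (hNP hn) hx
      rw [show x = n + a * (-z) by linear_combination -hz]
      exact add_mem (Ideal.mem_sup_left hn) (Ideal.mem_sup_right
        (Ideal.mem_span_singleton_mul.mpr ⟨-z, neg_mem hzP, rfl⟩))
    rwa [le_antisymm (Ideal.le_of_le_sup_span_mul ha hN hle) hNP]

/-- The maximal ideal is minimal over (a), so Krull's principal ideal theorem bounds its height by
one. -/
theorem Ideal.IsPrime.eq_bot_of_notMem_of_maximalIdeal_le_radical {B : Type*} [CommRing B]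
    [IsDomain B] [IsLocalRing B] [IsNoetherianRing B] {a : B}
    (ha : a ∈ maximalIdeal B) (h : maximalIdeal B ≤ (Ideal.span {a}).radical)
    {P : Ideal B} (hP : P.IsPrime) (haP : a ∉ P) : P = ⊥ := by
  have hmin : maximalIdeal B ∈ (Ideal.span {a}).minimalPrimes :=
    ⟨⟨inferInstance, (Ideal.span_singleton_le_iff_mem _).mpr ha⟩, fun Q hQ _ =>
      (IsLocalRing.eq_maximalIdeal_of_le_radical h hQ.1
        (hQ.2 (Ideal.mem_span_singleton_self a))).ge⟩
  have hht := Ideal.height_le_one_of_isPrincipal_of_mem_minimalPrimes (Ideal.span {a}) _ hmin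
  have hlt : P < maximalIdeal B := lt_of_le_of_ne (le_maximalIdeal hP.ne_top)
    (fun hh => haP (hh ▸ ha))
  have h0 : P.height < 1 := Ideal.height_le_iff.mp hht P hP hlt
  rwa [Order.lt_one_iff, Ideal.height_eq_zero_iff_eq_bot] at h0

/-! ### Valuation topology, adic topology and the completion -/

theorem AddValuation.le_map_of_mem_maximalIdeal_pow {A : Type*} [CommRing A] [IsLocalRing A]
    (u : AddValuation A (WithTop ℤ)) (h0 : ∀ a, 0 ≤ u a) (h1 : ∀ a ∈ maximalIdeal A, 1 ≤ u a)
    (n : ℕ) {a : A} (ha : a ∈ maximalIdeal A ^ n) : ((n : ℤ) : WithTop ℤ) ≤ u a := by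
  induction n generalizing a with
  | zero => simpa using h0 a
  | succ n ih =>
    rw [pow_succ] at ha
    refine Submodule.mul_induction_on ha (fun x hx y hy => ?_) (fun x y hx hy => u.map_le_add hx hy)
    rw [u.map_mul]
    have := add_le_add (ih hx) (h1 y hy)
    simpa using this

theorem AdicCompletion.exists_evalₐ_eq_mk {A : Type*} [CommRing A] (J : Ideal A)
    (x : AdicCompletion J A) : ∃ f : ℕ → A, (∀ n, evalₐ J n x = Ideal.Quotient.mk (J ^ n) (f n)) ∧
      ∀ m n, m ≤ n → f n - f m ∈ J ^ m := by
  obtain ⟨f, rfl⟩ := AdicCompletion.mk_surjective J A x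
  refine ⟨f, fun n => evalₐ_mk J n f, fun m n hmn => ?_⟩
  have := SModEq.sub_mem.mp (f.2 hmn).symm
  simpa using this

theorem AdicCompletion.eq_zero_of_forall_evalₐ {A : Type*} [CommRing A] {J : Ideal A}
    {x : AdicCompletion J A} (h : ∀ n, evalₐ J n x = 0) : x = 0 :=
  ext_evalₐ fun n => by rw [h, _root_.map_zero]

theorem WithTop.int_add_lt {x y : WithTop ℤ} {k l : ℤ} (hx : x < k) (hy : y < l) :
    x + y < ((k + l : ℤ) : WithTop ℤ) := by
  lift x to ℤ using hx.ne_top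
  lift y to ℤ using hy.ne_top
  norm_cast at *
  omega

/-- If the topology defined by a valuation is the adic topology, the completion is a domain. -/
theorem IsAnalyticallyIrreducible.of_addValuation {A : Type*} [CommRing A] [IsLocalRing A]
    (u : AddValuation A (WithTop ℤ)) (h0 : ∀ a, 0 ≤ u a) (h1 : ∀ a ∈ maximalIdeal A, 1 ≤ u a)
    (h : ∀ n : ℕ, ∃ k : ℕ, ∀ a, ((k : ℤ) : WithTop ℤ) ≤ u a → a ∈ maximalIdeal A ^ n) :
    IsAnalyticallyIrreducible A := by
  have hnt : Nontrivial (AdicCompletion (maximalIdeal A) A) := by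
    refine ⟨1, 0, fun h10 => ?_⟩
    have := congrArg (AdicCompletion.evalₐ (maximalIdeal A) 1) h10
    rw [map_one, map_zero, ← map_one (Ideal.Quotient.mk _), Ideal.Quotient.eq_zero_iff_mem,
      pow_one] at this
    exact (Ideal.ne_top_iff_one _).mp (maximalIdeal.isMaximal A).ne_top this
  have hnz : NoZeroDivisors (AdicCompletion (maximalIdeal A) A) := by
    refine ⟨fun {x y} hxy => ?_⟩
    obtain ⟨f, hf, hf'⟩ := AdicCompletion.exists_evalₐ_eq_mk _ x
    obtain ⟨g, hg, hg'⟩ := AdicCompletion.exists_evalₐ_eq_mk _ y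
    by_contra! hne
    obtain ⟨p, hp⟩ : ∃ p, f p ∉ maximalIdeal A ^ p := by
      by_contra! hc
      exact hne.1 (AdicCompletion.eq_zero_of_forall_evalₐ fun n => by
        rw [hf, Ideal.Quotient.eq_zero_iff_mem.mpr (hc n)])
    obtain ⟨q, hq⟩ : ∃ q, g q ∉ maximalIdeal A ^ q := by
      by_contra! hc
      exact hne.2 (AdicCompletion.eq_zero_of_forall_evalₐ fun n => by
        rw [hg, Ideal.Quotient.eq_zero_iff_mem.mpr (hc n)])
    obtain ⟨k, hk⟩ := h p
    obtain ⟨l, hl⟩ := h q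
    -- At this precision both approximants are still outside their powers of the maximal ideal, so
    -- their product has value below k + l; yet it lies in the N-th power.
    set N := max (max p q) (k + l)
    have hfN : f N ∉ maximalIdeal A ^ p := fun hc => hp (by
      have := sub_mem hc (hf' p N (by omega))
      simpa using this)
    have hgN : g N ∉ maximalIdeal A ^ q := fun hc => hq (by
      have := sub_mem hc (hg' q N (by omega))
      simpa using this)
    have huf : u (f N) < ((k : ℤ) : WithTop ℤ) := lt_of_not_ge fun hc => hfN (hk _ hc)
    have hug : u (g N) < ((l : ℤ) : WithTop ℤ) := lt_of_not_ge fun hc => hgN (hl _ hc)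
    have hfg : f N * g N ∈ maximalIdeal A ^ N := by
      rw [← Ideal.Quotient.eq_zero_iff_mem, map_mul, ← hf, ← hg, ← map_mul, hxy, map_zero]
    have h2 := u.le_map_of_mem_maximalIdeal_pow h0 h1 N hfg
    rw [u.map_mul] at h2
    have h3 := h2.trans_lt (WithTop.int_add_lt huf hug)
    norm_cast at h3
    omega
  exact NoZeroDivisors.to_isDomain _

/-- The ideal of the completion formed by the limits of sequences whose values tend to infinity. -/
def AddValuation.completionSupp {A : Type*} [CommRing A] (J : Ideal A)
    (u : AddValuation A (WithTop ℤ)) (h0 : ∀ a, 0 ≤ u a) : Ideal (AdicCompletion J A) where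
  carrier := {x | ∀ l : ℕ, ∃ y : A, AdicCompletion.evalₐ J l x = Ideal.Quotient.mk (J ^ l) y ∧
    ((l : ℤ) : WithTop ℤ) ≤ u y}
  add_mem' {x x'} hx hx' l := by
    obtain ⟨y, hy, hu⟩ := hx l
    obtain ⟨y', hy', hu'⟩ := hx' l
    exact ⟨y + y', by rw [_root_.map_add, hy, hy', _root_.map_add], u.map_le_add hu hu'⟩
  zero_mem' l := ⟨0, by simp, by rw [u.map_zero]; exact le_top⟩
  smul_mem' c x hx l := by
    obtain ⟨y, hy, hu⟩ := hx l
    obtain ⟨r, hr⟩ := Ideal.Quotient.mk_surjective (AdicCompletion.evalₐ J l c)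
    refine ⟨r * y, by rw [smul_eq_mul, _root_.map_mul, hy, ← hr, _root_.map_mul], ?_⟩
    rw [u.map_mul]
    exact hu.trans (le_add_of_nonneg_left (h0 r))

/-- Outside this ideal, approximants eventually have value below some k, respectively l. The product
of two such approximants then has value below k + l, while membership of the product at precision k
+ l would force at least k + l. -/
theorem AddValuation.completionSupp_isPrime {A : Type*} [CommRing A] [IsLocalRing A]
    (u : AddValuation A (WithTop ℤ)) (h0 : ∀ a, 0 ≤ u a)
    (h1 : ∀ a ∈ maximalIdeal A, 1 ≤ u a) :
    (u.completionSupp (maximalIdeal A) h0).IsPrime := by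
  refine ⟨(Ideal.ne_top_iff_one _).mpr fun hone => ?_, fun {x y} hxy => ?_⟩
  · obtain ⟨y, hy, hu⟩ := hone 1
    rw [_root_.map_one, ← _root_.map_one (Ideal.Quotient.mk _), Ideal.Quotient.mk_eq_mk_iff_sub_mem, pow_one]
      at hy
    have h := u.map_le_add (h1 _ hy) (by simpa using hu)
    rw [sub_add_cancel, u.map_one] at h
    exact absurd h (by decide)
  · obtain ⟨f, hf, hf'⟩ := AdicCompletion.exists_evalₐ_eq_mk _ x
    obtain ⟨g, hg, hg'⟩ := AdicCompletion.exists_evalₐ_eq_mk _ y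
    by_contra! hne
    have key : ∀ {z : AdicCompletion (maximalIdeal A) A} {f : ℕ → A},
        (∀ n, AdicCompletion.evalₐ _ n z = Ideal.Quotient.mk (maximalIdeal A ^ n) (f n)) →
        (∀ m n, m ≤ n → f n - f m ∈ maximalIdeal A ^ m) →
        z ∉ u.completionSupp (maximalIdeal A) h0 →
        ∃ k : ℕ, ∀ n, k ≤ n → u (f n) < ((k : ℤ) : WithTop ℤ) := by
      intro z f hf hf' hz
      obtain ⟨k, hk⟩ := not_forall.mp hz
      refine ⟨k, fun n hkn => lt_of_not_ge fun hc => hk ⟨f n, ?_, hc⟩⟩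
      rw [hf, eq_comm, Ideal.Quotient.mk_eq_mk_iff_sub_mem]
      exact hf' k n hkn
    obtain ⟨k, hk⟩ := key hf hf' hne.1
    obtain ⟨l, hl⟩ := key hg hg' hne.2
    obtain ⟨z, hz, hu⟩ := hxy (k + l)
    rw [_root_.map_mul, hf, hg, ← _root_.map_mul, Ideal.Quotient.mk_eq_mk_iff_sub_mem] at hz
    have h2 := u.map_le_add (u.le_map_of_mem_maximalIdeal_pow h0 h1 _ hz) hu
    rw [sub_add_cancel, u.map_mul] at h2
    have h3 := h2.trans_lt (WithTop.int_add_lt (hk _ (by omega)) (hl _ (by omega)))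
    norm_cast at h3
    omega

theorem AddValuation.eq_top_of_algebraMap_mem_completionSupp {A : Type*} [CommRing A] [IsLocalRing A]
    (u : AddValuation A (WithTop ℤ)) (h0 : ∀ a, 0 ≤ u a)
    (h1 : ∀ a ∈ maximalIdeal A, 1 ≤ u a) {a : A}
    (ha : algebraMap A _ a ∈ u.completionSupp (maximalIdeal A) h0) : u a = ⊤ := by
  have h : ∀ l : ℕ, ((l : ℤ) : WithTop ℤ) ≤ u a := by
    intro l
    obtain ⟨y, hy, hu⟩ := ha l
    rw [AlgHom.commutes, Ideal.Quotient.algebraMap_eq, Ideal.Quotient.mk_eq_mk_iff_sub_mem] at hy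
    have := u.map_le_add (u.le_map_of_mem_maximalIdeal_pow h0 h1 _ hy) hu
    rwa [sub_add_cancel] at this
  by_contra hne
  obtain ⟨t, ht⟩ := WithTop.ne_top_iff_exists.mp hne
  have := h (t.toNat + 1)
  rw [← ht] at this
  norm_cast at this
  omega

/-- The images of the chain in the Artinian ring A/𝔪^l stabilize. -/
theorem Ideal.exists_forall_le_sup_pow_maximalIdeal {A : Type*} [CommRing A] [IsLocalRing A]
    [IsNoetherianRing A] {J : ℕ → Ideal A} (hJ : Antitone J) (l : ℕ) :
    ∃ c, ∀ k k', c ≤ k → J k ≤ J k' ⊔ maximalIdeal A ^ l := by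
  have hart : IsArtinianRing (A ⧸ maximalIdeal A ^ l) := by
    rcases Nat.eq_zero_or_pos l with rfl | hl
    · have : Subsingleton (A ⧸ maximalIdeal A ^ 0) :=
        Ideal.Quotient.subsingleton_iff.mpr (by simp)
      infer_instance
    · refine IsLocalRing.quotient_artinian_of_mem_minimalPrimes_of_isLocalRing _
        ⟨⟨inferInstance, Ideal.pow_le_self hl.ne'⟩, fun Q hQ _ => ?_⟩
      exact hQ.1.le_of_pow_le hQ.2
  let G : ℕ →o (Ideal (A ⧸ maximalIdeal A ^ l))ᵒᵈ :=
    ⟨fun k => OrderDual.toDual ((J k).map (Ideal.Quotient.mk _)),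
      fun k k' h => Ideal.map_mono (hJ h)⟩
  obtain ⟨c, hc⟩ := IsArtinian.monotone_stabilizes G
  have key : ∀ k, c ≤ k → J c ≤ J k ⊔ maximalIdeal A ^ l := by
    intro k hk
    have : (J c).map (Ideal.Quotient.mk (maximalIdeal A ^ l)) = (J k).map (Ideal.Quotient.mk _) :=
      hc k hk
    have h2 := Ideal.le_comap_map (f := Ideal.Quotient.mk (maximalIdeal A ^ l)) (I := J c)
    rw [this, Ideal.comap_map_of_surjective _ Ideal.Quotient.mk_surjective,
      ← RingHom.ker_eq_comap_bot, Ideal.mk_ker] at h2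
    exact h2
  refine ⟨c, fun k k' hk => (hJ hk).trans ?_⟩
  rcases le_total c k' with h | h
  · exact key k' h
  · exact (hJ h).trans le_sup_left

/-- The valuation ideals `{u ≥ k}` of a ring. -/
def AddValuation.geIdeal {A : Type*} [CommRing A]
    (u : AddValuation A (WithTop ℤ)) (h0 : ∀ a, 0 ≤ u a) (k : ℕ) : Ideal A where
  carrier := {a | ((k : ℤ) : WithTop ℤ) ≤ u a}
  add_mem' ha hb := u.map_le_add ha hb
  zero_mem' := by simp
  smul_mem' c a ha := by
    rw [Set.mem_ofPred, smul_eq_mul, u.map_mul]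
    exact le_trans ha (le_add_of_nonneg_left (h0 c))

/-- Chevalley's argument: an element of large value outside 𝔪^n is corrected successively by
elements of higher and higher powers of 𝔪 so that its value grows without bound. The limit lies in
the ideal and is nonzero modulo 𝔪^n. -/
theorem AddValuation.completionSupp_ne_bot {A : Type*} [CommRing A] [IsLocalRing A]
    [IsNoetherianRing A] (u : AddValuation A (WithTop ℤ)) (h0 : ∀ a, 0 ≤ u a) {n : ℕ}
    (hn : ∀ k : ℕ, ∃ a, ((k : ℤ) : WithTop ℤ) ≤ u a ∧ a ∉ maximalIdeal A ^ n) :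
    u.completionSupp (maximalIdeal A) h0 ≠ ⊥ := by
  have hJ : Antitone (u.geIdeal h0) := fun k k' h a ha =>
    le_trans (by exact_mod_cast h) (show ((k' : ℤ) : WithTop ℤ) ≤ u a from ha)
  choose c₀ hc₀ using fun l => Ideal.exists_forall_le_sup_pow_maximalIdeal hJ l
  -- Summing makes the thresholds dominate `c₀`; the added 1 forces c(l) ≥ l, so the values tend to
  -- infinity.
  let c : ℕ → ℕ := fun l => ∑ i ∈ Finset.range (l + 1), (c₀ i + 1)
  have hc : ∀ l, c₀ l ≤ c l := fun l => (Nat.le_succ _).trans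
    (Finset.single_le_sum (f := fun i => c₀ i + 1) (fun _ _ => Nat.zero_le _)
      (Finset.self_mem_range_succ l))
  have hcl : ∀ l, l ≤ c l := by
    intro l
    have : ∑ i ∈ Finset.range (l + 1), 1 ≤ c l := Finset.sum_le_sum fun i _ => by omega
    simp at this
    omega
  have step : ∀ l (y : u.geIdeal h0 (c l)), ∃ z : u.geIdeal h0 (c (l + 1)),
      (y : A) - z ∈ maximalIdeal A ^ l := by
    intro l y
    obtain ⟨z, hz, t, ht, hzt⟩ := Submodule.mem_sup.mp (hc₀ l (c l) (c (l + 1)) (hc l) y.2)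
    exact ⟨⟨z, hz⟩, by rw [← hzt]; simpa using ht⟩
  choose nxt hnxt using step
  obtain ⟨a, hau, han⟩ := hn (c n)
  -- Starting at level n keeps every correction inside 𝔪^n, so the class of a modulo 𝔪^n never
  -- changes.
  let f : (j : ℕ) → u.geIdeal h0 (c (n + j)) := fun j =>
    Nat.rec (motive := fun j => u.geIdeal h0 (c (n + j))) ⟨a, hau⟩ (fun j y => nxt (n + j) y) j
  have hf : ∀ j, (f j : A) - f (j + 1) ∈ maximalIdeal A ^ (n + j) := fun j => hnxt (n + j) (f j)
  have hfn : ∀ j, (f 0 : A) - f j ∈ maximalIdeal A ^ n := by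
    intro j
    induction j with
    | zero => simp
    | succ j ih =>
      have := add_mem ih (Ideal.pow_le_pow_right (Nat.le_add_right n j) (hf j))
      simpa using this
  let F : AdicCompletion.AdicCauchySequence (maximalIdeal A) A :=
    AdicCompletion.AdicCauchySequence.mk _ _ (fun j => (f j : A)) fun j => by
      rw [SModEq.sub_mem]
      have := Ideal.pow_le_pow_right (Nat.le_add_left j n) (hf j)
      simpa using this
  intro hbot
  have hmem : AdicCompletion.mk _ _ F ∈ u.completionSupp (maximalIdeal A) h0 := fun l =>
    ⟨f l, AdicCompletion.evalₐ_mk _ _ _, hJ ((Nat.le_add_left l n).trans (hcl _)) (f l).2⟩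
  rw [hbot, Ideal.mem_bot] at hmem
  have h2 : Ideal.Quotient.mk (maximalIdeal A ^ n) (f n : A) = 0 :=
    (AdicCompletion.evalₐ_mk _ n F).symm.trans (by rw [hmem, _root_.map_zero])
  rw [Ideal.Quotient.eq_zero_iff_mem] at h2
  have h3 := add_mem (hfn n) h2
  exact han (by simpa [f] using h3)

/-- On a one-dimensional analytically irreducible local domain, a valuation which is positive on
the maximal ideal defines the adic topology. -/
theorem IsAnalyticallyIrreducible.exists_forall_mem_pow {A : Type*} [CommRing A] [IsLocalRing A]
    [IsNoetherianRing A] [IsDomain A] (hdim : ringKrullDim A = 1)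
    (hA : IsAnalyticallyIrreducible A) (u : AddValuation A (WithTop ℤ)) (h0 : ∀ a, 0 ≤ u a)
    (h1 : ∀ a ∈ maximalIdeal A, 1 ≤ u a) (htop : ∀ a, u a = ⊤ → a = 0) (n : ℕ) :
    ∃ k : ℕ, ∀ a, ((k : ℤ) : WithTop ℤ) ≤ u a → a ∈ maximalIdeal A ^ n := by
  by_contra! hn
  have := hA
  unfold IsAnalyticallyIrreducible at this
  obtain ⟨hfield, hrad⟩ := ringKrullDim_eq_one_iff_of_isLocalRing_isDomain.mp hdim
  obtain ⟨a, ham, ha0⟩ : ∃ a ∈ maximalIdeal A, a ≠ 0 :=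
    Submodule.exists_mem_ne_zero_of_ne_bot (isField_iff_maximalIdeal_eq.not.mp hfield)
  have hfg := (maximalIdeal A).fg_of_isNoetherianRing
  have hmax := AdicCompletion.maximalIdeal_eq_map (R := A)
  have ham' : algebraMap A _ a ∈ maximalIdeal (AdicCompletion (maximalIdeal A) A) := by
    rw [hmax]; exact Ideal.mem_map_of_mem _ ham
  have hrad' : maximalIdeal (AdicCompletion (maximalIdeal A) A) ≤
      (Ideal.span {algebraMap A _ a}).radical := by
    rw [hmax]
    refine (Ideal.map_mono (hrad a ha0)).trans ((Ideal.map_radical_le _).trans ?_)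
    rw [Ideal.map_span, Set.image_singleton]
  have hnoeth : IsNoetherianRing (AdicCompletion (maximalIdeal A) A) :=
    .of_isAdicComplete_maximalIdeal (by rw [hmax]; exact hfg.map _) ham' hrad'
  -- The prime is nonzero by the assumed failure at n, but it avoids a, since a has finite value;
  -- dimension one then makes it zero.
  exact u.completionSupp_ne_bot h0 hn
    ((u.completionSupp_isPrime h0 h1).eq_bot_of_notMem_of_maximalIdeal_le_radical ham' hrad'
      fun hc => ha0 (htop a (u.eq_top_of_algebraMap_mem_completionSupp h0 h1 hc)))

/-! ### Discrete valuations on fields, integral closure and residue fields -/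

theorem WithTop.one_le_iff_int_pos {x : WithTop ℤ} : 1 ≤ x ↔ 0 < x := by
  induction x using WithTop.recTopCoe with
  | top => simp
  | coe n => norm_cast

theorem AddValuation.nonneg_of_isIntegral {A F : Type*} [CommRing A] [Field F] [Algebra A F]
    (w : AddValuation F (WithTop ℤ)) (h0 : ∀ a : A, 0 ≤ w (algebraMap A F a)) {x : F}
    (hx : IsIntegral A x) : 0 ≤ w x := by
  let V := AddValuation.toValuation w
  have hx' : IsIntegral V.integer x :=
    hx.map_of_comp_eq ((algebraMap A F).codRestrict V.integer fun a => h0 a) (RingHom.id F) rfl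
  exact (Valuation.integer.integers V).mem_of_integral hx'

section Field

variable {F : Type*} [Field F]

theorem AddValuation.add_inv_eq_zero (w : AddValuation F (WithTop ℤ)) {x : F} (hx : x ≠ 0) :
    w x + w x⁻¹ = 0 := by
  rw [← w.map_mul, mul_inv_cancel₀ hx, w.map_one]

theorem AddValuation.inv_nonneg_of_eq_zero (w : AddValuation F (WithTop ℤ)) {x : F}
    (hx : w x = 0) : 0 ≤ w x⁻¹ := by
  have hx0 : x ≠ 0 := w.ne_top_iff.mp (by rw [hx]; exact WithTop.zero_ne_top)
  have := w.add_inv_eq_zero hx0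
  rw [hx, zero_add] at this
  exact this.ge

theorem AddValuation.le_iff_nonneg_div (w : AddValuation F (WithTop ℤ)) {x y : F} (hx : x ≠ 0) :
    w x ≤ w y ↔ 0 ≤ w (y * x⁻¹) := by
  have h := w.add_inv_eq_zero hx
  have hy : w y = w (y * x⁻¹) + w x := by rw [← w.map_mul, inv_mul_cancel_right₀ hx]
  rw [hy]
  lift w x to ℤ using w.ne_top_iff.mpr hx with n
  induction w (y * x⁻¹) using WithTop.recTopCoe with
  | top => simp
  | coe k => norm_cast; omega

/-- Quotients show that the valuation ring determines the order of values. An element of least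
positive value for one valuation is so for the other, and comparison with its powers fixes all
values. -/
theorem AddValuation.eq_of_nonneg_iff {w₁ w₂ : AddValuation F (WithTop ℤ)}
    (h : ∀ x, 0 ≤ w₁ x ↔ 0 ≤ w₂ x) (h₁ : ∃ x, w₁ x = 1) (h₂ : ∃ x, w₂ x = 1) : w₁ = w₂ := by
  have hle : ∀ {x y : F}, x ≠ 0 → (w₁ x ≤ w₁ y ↔ w₂ x ≤ w₂ y) := fun hx => by
    rw [w₁.le_iff_nonneg_div hx, w₂.le_iff_nonneg_div hx, h]
  have heq : ∀ {x y : F}, x ≠ 0 → y ≠ 0 → (w₁ x = w₁ y ↔ w₂ x = w₂ y) := fun hx hy => by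
    rw [le_antisymm_iff, le_antisymm_iff, hle hx, hle hy]
  obtain ⟨p, hp⟩ := h₁
  obtain ⟨q, hq⟩ := h₂
  have hp0 : p ≠ 0 := w₁.ne_top_iff.mp (by rw [hp]; exact WithTop.one_ne_top)
  have hq0 : q ≠ 0 := w₂.ne_top_iff.mp (by rw [hq]; exact WithTop.one_ne_top)
  have hpos : ∀ {x : F}, x ≠ 0 → (1 ≤ w₁ x ↔ 1 ≤ w₂ x) := fun {x} hx => by
    have := hle (y := 1) hx
    rw [w₁.map_one, w₂.map_one] at this
    rw [WithTop.one_le_iff_int_pos, WithTop.one_le_iff_int_pos, ← not_le, ← not_le, this]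
  have hp2 : w₂ p = 1 := by
    refine le_antisymm ?_ ((hpos hp0).mp hp.ge)
    rw [← hq, ← hle hp0, hp, hpos hq0, hq]
  have key : ∀ x (n : ℕ), w₁ x = ((n : ℤ) : WithTop ℤ) → w₂ x = ((n : ℤ) : WithTop ℤ) := by
    intro x n hx
    have hx0 : x ≠ 0 := w₁.ne_top_iff.mp (by rw [hx]; exact WithTop.coe_ne_top)
    have : w₁ x = w₁ (p ^ n) := by rw [hx, w₁.map_pow, hp]; simp
    rw [(heq hx0 (pow_ne_zero n hp0)).mp this, w₂.map_pow, hp2]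
    simp
  refine AddValuation.ext fun x => ?_
  by_cases hx : x = 0
  · rw [hx, w₁.map_zero, w₂.map_zero]
  · have e1 := w₁.add_inv_eq_zero hx
    have e2 := w₂.add_inv_eq_zero hx
    have k1 := key x
    have k2 := key x⁻¹
    have t1 := w₁.ne_top_iff.mpr hx
    have t2 := w₂.ne_top_iff.mpr hx
    have t3 := w₁.ne_top_iff.mpr (inv_ne_zero hx)
    have t4 := w₂.ne_top_iff.mpr (inv_ne_zero hx)
    lift w₁ x to ℤ using t1 with a
    lift w₂ x to ℤ using t2 with b
    lift w₁ x⁻¹ to ℤ using t3 with c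
    lift w₂ x⁻¹ to ℤ using t4 with d
    norm_cast at *
    -- Comparison with powers covers only nonnegative values; negative ones pass through the
    -- inverse.
    rcases le_total 0 a with ha | ha
    · exact (k1 a.toNat (by omega)).symm ▸ by omega
    · have := k2 c.toNat (by omega)
      omega

variable {A : Type*} [CommRing A] [Algebra A F] {w : AddValuation F (WithTop ℤ)}

theorem isUnit_integralClosure_iff (hw : ∀ x : F, 0 ≤ w x ↔ x ∈ integralClosure A F)
    (c : integralClosure A F) : IsUnit c ↔ w c = 0 := by
  constructor
  · rintro ⟨u, rfl⟩
    have h1 := (hw _).mpr (u : integralClosure A F).2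
    have h2 := (hw _).mpr (u⁻¹ : (integralClosure A F)ˣ).val.2
    have h3 : w ((u : integralClosure A F) : F) + w (((u⁻¹ : (integralClosure A F)ˣ) :
        integralClosure A F) : F) = 0 := by
      rw [← w.map_mul, ← MulMemClass.coe_mul, Units.mul_inv, OneMemClass.coe_one, w.map_one]
    refine le_antisymm ?_ h1
    rw [← h3]
    exact le_add_of_nonneg_right h2
  · intro h
    have hc0 : (c : F) ≠ 0 := w.ne_top_iff.mp (by rw [h]; exact WithTop.zero_ne_top)
    exact IsUnit.of_mul_eq_one ⟨(c : F)⁻¹, (hw _).mp (w.inv_nonneg_of_eq_zero h)⟩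
      (Subtype.ext (mul_inv_cancel₀ hc0))

theorem not_isUnit_integralClosure_iff (hw : ∀ x : F, 0 ≤ w x ↔ x ∈ integralClosure A F)
    (c : integralClosure A F) : ¬ IsUnit c ↔ 1 ≤ w c := by
  rw [isUnit_integralClosure_iff hw, WithTop.one_le_iff_int_pos,
    lt_iff_le_and_ne, and_iff_right ((hw _).mpr c.2), ne_comm]

theorem isLocalRing_integralClosure (hw : ∀ x : F, 0 ≤ w x ↔ x ∈ integralClosure A F) :
    IsLocalRing (integralClosure A F) :=
  IsLocalRing.of_nonunits_add fun a b ha hb => by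
    rw [mem_nonunits_iff, not_isUnit_integralClosure_iff hw] at *
    exact w.map_le_add ha hb

end Field

/-- A domain embedded in a field with a valuation whose valuation ring is the integral closure of
the domain is residually rational if the valuation is positive on the maximal ideal and each
element of the valuation ring is congruent to an element of the domain. -/
theorem IsResiduallyRational.of_addValuation {A F : Type*} [CommRing A] [IsDomain A]
    [IsLocalRing A] [Field F] [Algebra A F] (hinj : Function.Injective (algebraMap A F))
    {w : AddValuation F (WithTop ℤ)} (hw : ∀ x : F, 0 ≤ w x ↔ x ∈ integralClosure A F)
    (h1 : ∀ a ∈ maximalIdeal A, 1 ≤ w (algebraMap A F a))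
    (hres : ∀ x : F, 0 ≤ w x → ∃ a : A, 1 ≤ w (x - algebraMap A F a)) :
    IsResiduallyRational A := by
  -- F may be larger than the fraction field (as for I = 0), so w is pulled back. The pullback need
  -- not be normalized, but its valuation ring is still the integral closure.
  let ψ : FractionRing A →ₐ[A] F := IsFractionRing.liftAlgHom (g := Algebra.ofId A F) hinj
  let u : AddValuation (FractionRing A) (WithTop ℤ) := w.comap ψ.toRingHom
  have hu : ∀ x : FractionRing A, 0 ≤ u x ↔ x ∈ integralClosure A (FractionRing A) := fun x =>
    (hw (ψ x)).trans (isIntegral_algHom_iff ψ ψ.toRingHom.injective)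
  have hloc := isLocalRing_integralClosure hu
  have hhom : IsLocalHom (algebraMap A (integralClosure A (FractionRing A))) := by
    refine ⟨fun a ha => ?_⟩
    by_contra hna
    have := h1 a ((mem_maximalIdeal a).mpr hna)
    refine (not_isUnit_integralClosure_iff hu _).mpr ?_ ha
    change 1 ≤ w (ψ (algebraMap A (FractionRing A) a))
    rwa [AlgHom.commutes]
  refine ⟨hloc, hhom, RingHom.injective _, fun y => ?_⟩
  obtain ⟨c, rfl⟩ := residue_surjective y
  obtain ⟨a, ha⟩ := hres (ψ c) ((hu c).mpr c.2)
  refine ⟨residue A a, ?_⟩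
  rw [ResidueField.map_residue, ← sub_eq_zero, ← map_sub, residue_eq_zero_iff, ← neg_mem_iff,
    neg_sub, mem_maximalIdeal, mem_nonunits_iff, not_isUnit_integralClosure_iff hu]
  change 1 ≤ w (ψ ((c : FractionRing A) - algebraMap A (FractionRing A) a))
  rwa [map_sub, AlgHom.commutes]

theorem IsResiduallyRational.one_le_of_mem_maximalIdeal {A : Type*} [CommRing A] [IsDomain A]
    [IsLocalRing A] (hA : IsResiduallyRational A) {w : AddValuation (FractionRing A) (WithTop ℤ)}
    (hw : ∀ x, 0 ≤ w x ↔ x ∈ integralClosure A (FractionRing A)) {a : A}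
    (ha : a ∈ maximalIdeal A) : 1 ≤ w (algebraMap A (FractionRing A) a) := by
  obtain ⟨hloc, hhom, -⟩ := hA
  exact (not_isUnit_integralClosure_iff hw (algebraMap A _ a)).mp
    fun h => ha (isUnit_of_map_unit _ _ h)

theorem IsResiduallyRational.exists_one_le_sub {A : Type*} [CommRing A] [IsDomain A]
    [IsLocalRing A] (hA : IsResiduallyRational A) {w : AddValuation (FractionRing A) (WithTop ℤ)}
    (hw : ∀ x, 0 ≤ w x ↔ x ∈ integralClosure A (FractionRing A)) {x : FractionRing A}
    (hx : 0 ≤ w x) : ∃ a : A, 1 ≤ w (x - algebraMap A (FractionRing A) a) := by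
  obtain ⟨hloc, hhom, hbij⟩ := hA
  obtain ⟨y, hy⟩ := hbij.2 (residue _ ⟨x, (hw x).mp hx⟩)
  obtain ⟨a, rfl⟩ := residue_surjective y
  rw [ResidueField.map_residue, eq_comm, ← sub_eq_zero, ← map_sub, residue_eq_zero_iff,
    mem_maximalIdeal, mem_nonunits_iff, not_isUnit_integralClosure_iff hw] at hy
  exact ⟨a, hy⟩

/-! ### The field Q(R)[α] and its valuation -/

section Quadratic

variable {R : Type*} [CommRing R]

/-- The coordinates of an element of `Q(R)[α]` with respect to the basis `1, α`. -/
noncomputable def QuadraticExtension.coord (b : R) : QuadraticExtension b →ₐ[FractionRing R]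
    QuadraticAlgebra (FractionRing R) (algebraMap R (FractionRing R) b) 0 :=
  AdjoinRoot.liftAlgHom _ (Algebra.ofId _ _) QuadraticAlgebra.omega (by
    rw [eval₂_sub, eval₂_X_pow, eval₂_C, sq, QuadraticAlgebra.omega_mul_omega_eq_mk]
    ext <;> simp)

namespace QuadraticExtension

/-- The element `x + y α` of `Q(R)[α]`. -/
noncomputable def elt (b : R) (x y : FractionRing R) : QuadraticExtension b :=
  algebraMap _ _ x + algebraMap _ _ y * AdjoinRoot.root _

variable {b : R}

theorem root_mul_root : (AdjoinRoot.root _ * AdjoinRoot.root _ : QuadraticExtension b) =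
    algebraMap (FractionRing R) _ (algebraMap R _ b) := by
  have := AdjoinRoot.eval₂_root (X ^ 2 - C (algebraMap R (FractionRing R) b))
  rw [eval₂_sub, eval₂_X_pow, eval₂_C, sub_eq_zero] at this
  rw [← sq]
  exact this

@[simp]
theorem coord_elt (x y : FractionRing R) : coord b (elt b x y) = ⟨x, y⟩ := by
  have : coord b (AdjoinRoot.root _) = QuadraticAlgebra.omega :=
    AdjoinRoot.liftAlgHom_root _ _ _ _
  rw [elt, map_add, map_mul, AlgHom.commutes, AlgHom.commutes, this]
  ext <;> simp

theorem elt_add (x y x' y' : FractionRing R) :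
    elt b x y + elt b x' y' = elt b (x + x') (y + y') := by
  simp only [elt, map_add]; ring

theorem elt_mul (x y x' y' : FractionRing R) :
    elt b x y * elt b x' y' =
      elt b (x * x' + algebraMap R _ b * (y * y')) (x * y' + y * x') := by
  simp only [elt, map_add, map_mul]
  linear_combination (algebraMap _ (QuadraticExtension b) y) *
    (algebraMap _ (QuadraticExtension b) y') * root_mul_root (b := b)

theorem exists_eq_elt (z : QuadraticExtension b) : ∃ x y, z = elt b x y := by
  induction z using AdjoinRoot.induction_on with
  | ih p =>
    induction p using Polynomial.induction_on with
    | C a => exact ⟨a, 0, by simp [elt]⟩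
    | add p q hp hq =>
      obtain ⟨x, y, hxy⟩ := hp
      obtain ⟨x', y', hxy'⟩ := hq
      exact ⟨_, _, by rw [map_add, hxy, hxy', elt_add]⟩
    | monomial n a h =>
      obtain ⟨x, y, hxy⟩ := h
      refine ⟨x * 0 + algebraMap R _ b * (y * 1), x * 1 + y * 0, ?_⟩
      rw [show C a * X ^ (n + 1) = C a * X ^ n * X by ring, map_mul, hxy, AdjoinRoot.mk_X,
        show AdjoinRoot.root _ = elt b 0 1 by simp [elt], elt_mul]

theorem elt_injective {x y x' y' : FractionRing R} (h : elt b x y = elt b x' y') :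
    x = x' ∧ y = y' := by
  have := congrArg (coord b) h
  rw [coord_elt, coord_elt] at this
  exact ⟨congrArg QuadraticAlgebra.re this, congrArg QuadraticAlgebra.im this⟩

theorem two_nsmul_ne_add {m : ℤ} {x y : WithTop ℤ} (hm : Odd m) (hxy : x ≠ ⊤ ∨ y ≠ ⊤) :
    2 • x ≠ 2 • y + (m : WithTop ℤ) := by
  obtain ⟨k, rfl⟩ := hm
  rw [two_nsmul, two_nsmul]
  induction x using WithTop.recTopCoe <;> induction y using WithTop.recTopCoe
  · simp at hxy
  · exact (WithTop.coe_ne_top (α := ℤ)).symm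
  · exact WithTop.coe_ne_top (α := ℤ)
  · norm_cast; omega

/-- The two terms have values of opposite parity unless both vanish, so no cancellation occurs. -/
theorem map_sq_sub_mul_sq [IsDomain R] (v : AddValuation (FractionRing R) (WithTop ℤ)) {m : ℤ}
    (hb : v (algebraMap R (FractionRing R) b) = (m : WithTop ℤ)) (hm : Odd m)
    (x y : FractionRing R) :
    v (x ^ 2 - algebraMap R _ b * y ^ 2) = min (2 • v x) (2 • v y + (m : WithTop ℤ)) := by
  have h1 : v (x ^ 2) = 2 • v x := v.map_pow x 2
  have h2 : v (algebraMap R _ b * y ^ 2) = 2 • v y + (m : WithTop ℤ) := by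
    rw [v.map_mul, v.map_pow, hb, add_comm]
  by_cases hxy : x = 0 ∧ y = 0
  · simp [hxy.1, hxy.2, two_nsmul]
  · have hne : 2 • v x ≠ 2 • v y + (m : WithTop ℤ) := two_nsmul_ne_add hm (by
      rw [v.ne_top_iff, v.ne_top_iff]; tauto)
    rw [sub_eq_add_neg, v.map_add_of_distinct_val (by rwa [v.map_neg, h1, h2]), v.map_neg, h1, h2]

theorem norm_mk (x y : FractionRing R) :
    QuadraticAlgebra.norm (⟨x, y⟩ : QuadraticAlgebra _ (algebraMap R (FractionRing R) b) 0) =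
      x ^ 2 - algebraMap R _ b * y ^ 2 := by
  rw [QuadraticAlgebra.norm_def]; ring

/-- The extension of the valuation `2 v` to `Q(R)[α]` with value `m` at `α`. -/
noncomputable def valuation [IsDomain R] (v : AddValuation (FractionRing R) (WithTop ℤ)) {m : ℤ}
    (hb : v (algebraMap R (FractionRing R) b) = (m : WithTop ℤ)) (hm : Odd m) :
    AddValuation (QuadraticExtension b) (WithTop ℤ) :=
  AddValuation.of (fun z => v (QuadraticAlgebra.norm (coord b z)))
    (by simp) (by simp)
    -- With the norm's value rewritten as a minimum, the ultrametric inequality holds coordinate by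
    -- coordinate.
    (fun z z' => by
      obtain ⟨x, y, rfl⟩ := exists_eq_elt z
      obtain ⟨x', y', rfl⟩ := exists_eq_elt z'
      simp only [elt_add, coord_elt, norm_mk, map_sq_sub_mul_sq v hb hm]
      have mono : ∀ {p q r : WithTop ℤ}, min p q ≤ r → min (2 • p) (2 • q) ≤ 2 • r := by
        intro p q r h
        rcases min_le_iff.mp h with h | h
        · exact min_le_iff.mpr (Or.inl (nsmul_le_nsmul_right h 2))
        · exact min_le_iff.mpr (Or.inr (nsmul_le_nsmul_right h 2))
      refine le_min ((min_le_min (min_le_left _ _) (min_le_left _ _)).trans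
        (mono (v.map_add x x'))) ?_
      refine (min_le_min (min_le_right _ _) (min_le_right _ _)).trans ?_
      rw [min_add_add_right]
      exact add_le_add_left (mono (v.map_add y y')) _)
    (fun z z' => by rw [map_mul, map_mul, v.map_mul])

theorem valuation_elt [IsDomain R] (v : AddValuation (FractionRing R) (WithTop ℤ)) {m : ℤ}
    (hb : v (algebraMap R (FractionRing R) b) = (m : WithTop ℤ)) (hm : Odd m)
    (x y : FractionRing R) :
    valuation v hb hm (elt b x y) = min (2 • v x) (2 • v y + (m : WithTop ℤ)) := by
  rw [valuation, AddValuation.of_apply, coord_elt, norm_mk, map_sq_sub_mul_sq v hb hm]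

/-- For a root x, the value of x² - b would be ∞, but it is min(2v(x), m) ≤ m. -/
theorem irreducible_X_sq_sub_C [IsDomain R] (v : AddValuation (FractionRing R) (WithTop ℤ)) {m : ℤ}
    (hb : v (algebraMap R (FractionRing R) b) = (m : WithTop ℤ)) (hm : Odd m) :
    Irreducible (X ^ 2 - C (algebraMap R (FractionRing R) b)) := by
  refine irreducible_of_degree_le_three_of_not_isRoot ?_ fun x hx => ?_
  · rw [natDegree_X_pow_sub_C]; decide
  · have h0 : x ^ 2 - algebraMap R _ b * 1 ^ 2 = 0 := by simpa using hx
    have := map_sq_sub_mul_sq v hb hm x 1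
    rw [h0, v.map_zero, v.map_one, eq_comm, min_eq_top] at this
    exact absurd this.2 (by simp)

end QuadraticExtension

end Quadratic

/-! ### The ring R + Iα: normal form, units, dimension, adic topology -/

namespace ReesQuotient

variable {R : Type*} [CommRing R] {I : Ideal R} {b : R}

variable (I b) in
/-- The structure map `R → R[It] / ((t² - b) ∩ R[It])`. -/
noncomputable def of : R →+* ReesQuotient I b :=
  (mk I b).comp (algebraMap R (reesAlgebra I))

variable (b) in
/-- The class of `i t` for `i ∈ I`. -/
noncomputable def gen (i : I) : ReesQuotient I b :=
  mk I b ⟨monomial 1 (i : R), reesAlgebra.monomial_mem.mpr (by simp)⟩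

theorem map_mk (p : reesAlgebra I) : reesQuotientToQuadraticExtension I b (mk I b p) =
    polynomialToQuadraticExtension b p := rfl

theorem polynomial_C (r : R) : polynomialToQuadraticExtension b (C r) =
    QuadraticExtension.elt b (algebraMap R _ r) 0 := by
  simp [polynomialToQuadraticExtension, QuadraticExtension.elt]

theorem polynomial_X : polynomialToQuadraticExtension b X = QuadraticExtension.elt b 0 1 := by
  simp [polynomialToQuadraticExtension, QuadraticExtension.elt]

@[simp]
theorem map_of (r : R) : reesQuotientToQuadraticExtension I b (of I b r) =
    QuadraticExtension.elt b (algebraMap R _ r) 0 :=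
  polynomial_C r

@[simp]
theorem map_gen (i : I) : reesQuotientToQuadraticExtension I b (gen b i) =
    QuadraticExtension.elt b 0 (algebraMap R _ i) := by
  rw [gen, map_mk]
  change polynomialToQuadraticExtension b (monomial 1 (i : R)) = _
  rw [← C_mul_X_eq_monomial, map_mul, polynomial_C, polynomial_X, QuadraticExtension.elt_mul]
  simp

theorem map_of_add_gen (r : R) (i : I) :
    reesQuotientToQuadraticExtension I b (of I b r + gen b i) =
      QuadraticExtension.elt b (algebraMap R _ r) (algebraMap R _ i) := by
  rw [map_add, map_of, map_gen, QuadraticExtension.elt_add, add_zero, zero_add]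

theorem polynomial_monomial (n : ℕ) (a : R) :
    polynomialToQuadraticExtension b (monomial (2 * n) a) =
      QuadraticExtension.elt b (algebraMap R _ (b ^ n * a)) 0 ∧
    polynomialToQuadraticExtension b (monomial (2 * n + 1) a) =
      QuadraticExtension.elt b 0 (algebraMap R _ (b ^ n * a)) := by
  have h2 : polynomialToQuadraticExtension b (X ^ 2) =
      QuadraticExtension.elt b (algebraMap R _ b) 0 := by
    rw [pow_two (X : R[X]), map_mul, polynomial_X, QuadraticExtension.elt_mul]; simp
  have h2n : polynomialToQuadraticExtension b (X ^ (2 * n)) =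
      QuadraticExtension.elt b (algebraMap R _ (b ^ n)) 0 := by
    rw [pow_mul, map_pow, h2]
    induction n with
    | zero => simp [QuadraticExtension.elt]
    | succ n ih => rw [pow_succ, ih, QuadraticExtension.elt_mul, pow_succ, map_mul]; simp
  constructor
  · rw [← C_mul_X_pow_eq_monomial, map_mul, polynomial_C, h2n, QuadraticExtension.elt_mul]
    simp [mul_comm]
  · rw [← C_mul_X_pow_eq_monomial, pow_succ (X : R[X]), map_mul, map_mul, polynomial_C, h2n, polynomial_X,
      QuadraticExtension.elt_mul, QuadraticExtension.elt_mul]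
    simp [mul_comm]

theorem exists_polynomial_eq {p : R[X]} (hp : p ∈ reesAlgebra I) :
    ∃ (r : R) (i : I), polynomialToQuadraticExtension b p =
      QuadraticExtension.elt b (algebraMap R _ r) (algebraMap R _ i) := by
  let S : AddSubmonoid (QuadraticExtension b) :=
    { carrier := {z | ∃ (r : R) (i : I), z =
        QuadraticExtension.elt b (algebraMap R _ r) (algebraMap R _ i)}
      zero_mem' := ⟨0, 0, by simp [QuadraticExtension.elt]⟩
      add_mem' := by
        rintro _ _ ⟨r, i, rfl⟩ ⟨s, j, rfl⟩
        exact ⟨r + s, i + j, by simp [QuadraticExtension.elt_add]⟩ }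
  change _ ∈ S
  rw [p.as_sum_support, map_sum]
  refine sum_mem fun k _ => ?_
  rcases Nat.even_or_odd' k with ⟨n, rfl | rfl⟩
  · exact ⟨b ^ n * p.coeff (2 * n), 0, by rw [(polynomial_monomial n _).1]; simp⟩
  · exact ⟨0, ⟨b ^ n * p.coeff (2 * n + 1), I.mul_mem_left _
      (Ideal.pow_le_self (by omega) (hp (2 * n + 1)))⟩, by
        rw [(polynomial_monomial n _).2]; simp⟩

/-- As t² - b is monic, divisibility by it over Q(R) descends to R. Identities in the quotient can
therefore be checked in Q(R)[α]. -/
theorem map_injective (I : Ideal R) (b : R) :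
    Function.Injective (reesQuotientToQuadraticExtension I b) := by
  rw [injective_iff_map_eq_zero]
  intro z hz
  obtain ⟨p, rfl⟩ := Ideal.Quotient.mk_surjective z
  refine Ideal.Quotient.eq_zero_iff_mem.mpr (Ideal.mem_comap.mpr (Ideal.mem_span_singleton.mpr ?_))
  have h : (X ^ 2 - C (algebraMap R (FractionRing R) b) : (FractionRing R)[X]) ∣
      (p : R[X]).map (algebraMap R (FractionRing R)) := AdjoinRoot.mk_eq_zero.mp hz
  have hX : (X ^ 2 - C (algebraMap R (FractionRing R) b) : (FractionRing R)[X]) =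
      (X ^ 2 - C b : R[X]).map (algebraMap R (FractionRing R)) := by simp
  rw [hX, map_dvd_map _ (IsFractionRing.injective R _) (monic_X_pow_sub_C b two_ne_zero)] at h
  exact h

theorem exists_eq_of_add_gen (z : ReesQuotient I b) : ∃ r i, z = of I b r + gen b i := by
  obtain ⟨p, rfl⟩ := Ideal.Quotient.mk_surjective z
  obtain ⟨r, i, h⟩ := exists_polynomial_eq (b := b) p.2
  exact ⟨r, i, map_injective I b (by rw [map_of_add_gen]; exact h)⟩

theorem gen_add (i j : I) : gen b (i + j) = gen b i + gen b j :=
  map_injective I b (by simp [QuadraticExtension.elt_add])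

theorem gen_smul (r : R) (i : I) : gen b (r • i) = of I b r * gen b i :=
  map_injective I b (by simp [QuadraticExtension.elt_mul])

theorem mul_eq (r s : R) (i j : I) : (of I b r + gen b i) * (of I b s + gen b j) =
    of I b (r * s + b * (i * j)) + gen b (r • j + s • i) :=
  map_injective I b (by
    rw [map_mul]
    simp only [map_of_add_gen, QuadraticExtension.elt_mul]
    simp [mul_comm])

theorem mul_conj (r : R) (i : I) : (of I b r + gen b i) * (of I b r + gen b (-i)) =
    of I b (r ^ 2 - b * (i : R) ^ 2) :=
  map_injective I b (by
    rw [map_mul]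
    simp only [map_of_add_gen, QuadraticExtension.elt_mul, map_of]
    congr 1
    · simp; ring
    · simp; ring)

theorem of_add_gen_injective {r s : R} {i j : I} (h : of I b r + gen b i = of I b s + gen b j) :
    r = s ∧ i = j := by
  have h2 := congrArg (reesQuotientToQuadraticExtension I b) h
  rw [map_of_add_gen, map_of_add_gen] at h2
  obtain ⟨h3, h4⟩ := QuadraticExtension.elt_injective h2
  exact ⟨IsFractionRing.injective R _ h3, Subtype.ext (IsFractionRing.injective R _ h4)⟩

theorem gen_zero : gen b (0 : I) = 0 :=
  map_injective I b (by simp [QuadraticExtension.elt])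

theorem isNoetherianRing [IsNoetherianRing R] (I : Ideal R) (b : R) :
    IsNoetherianRing (ReesQuotient I b) := by
  let alg : Algebra R (ReesQuotient I b) := (of I b).toAlgebra
  let f : R × I →ₗ[R] ReesQuotient I b :=
    { toFun := fun x => of I b x.1 + gen b x.2
      map_add' := fun x y => by
        rw [Prod.fst_add, Prod.snd_add, map_add, gen_add]; ring
      map_smul' := fun r x => by
        rw [Prod.smul_fst, Prod.smul_snd, smul_eq_mul, map_mul, gen_smul, RingHom.id_apply,
          Algebra.smul_def, mul_add]
        rfl }
  have hf : LinearMap.range f = ⊤ := LinearMap.range_eq_top.mpr fun z => by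
    obtain ⟨r, i, rfl⟩ := exists_eq_of_add_gen z
    exact ⟨(r, i), rfl⟩
  have : IsNoetherian R (ReesQuotient I b) := isNoetherian_of_surjective f hf
  exact isNoetherian_of_tower R this

instance [Nontrivial R] : Nontrivial (ReesQuotient I b) :=
  ⟨1, 0, fun h => one_ne_zero (α := R) (of_add_gen_injective (b := b) (i := 0) (j := (0 : I))
    (by rw [map_one, map_zero, h])).1⟩

section Local

variable [IsLocalRing R]

/-- Modulo 𝔪 the norm r² - bi² is r², and an element with unit norm is a unit. -/
theorem isUnit_iff (hb : b ∈ maximalIdeal R) (r : R) (i : I) :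
    IsUnit (of I b r + gen b i) ↔ r ∉ maximalIdeal R := by
  constructor
  · intro h hr
    obtain ⟨y, hy⟩ := h.exists_right_inv
    obtain ⟨s, j, rfl⟩ := exists_eq_of_add_gen y
    rw [mul_eq, ← map_one (of I b), ← add_zero (of I b 1), ← gen_zero] at hy
    have h1 := (of_add_gen_injective hy).1
    refine (Ideal.ne_top_iff_one _).mp (maximalIdeal.isMaximal R).ne_top ?_
    rw [← h1]
    exact add_mem (Ideal.mul_mem_right _ _ hr) (Ideal.mul_mem_right _ _ hb)
  · intro hr
    have hN : r ^ 2 - b * (i : R) ^ 2 ∉ maximalIdeal R := fun hc => hr (by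
      have := add_mem hc (Ideal.mul_mem_right ((i : R) ^ 2) _ hb)
      rw [sub_add_cancel] at this
      exact (maximalIdeal.isMaximal R).isPrime.mem_of_pow_mem _ this)
    have := (notMem_maximalIdeal.mp hN).map (of I b)
    rw [← mul_conj] at this
    exact isUnit_of_mul_isUnit_left this

theorem isLocalRing (I : Ideal R) (hb : b ∈ maximalIdeal R) : IsLocalRing (ReesQuotient I b) :=
  IsLocalRing.of_nonunits_add fun x y hx hy => by
    obtain ⟨r, i, rfl⟩ := exists_eq_of_add_gen x
    obtain ⟨s, j, rfl⟩ := exists_eq_of_add_gen y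
    rw [mem_nonunits_iff, isUnit_iff hb, not_not] at hx hy
    rw [add_add_add_comm, ← map_add, ← gen_add, mem_nonunits_iff, isUnit_iff hb, not_not]
    exact add_mem hx hy

theorem mem_maximalIdeal_iff [IsLocalRing (ReesQuotient I b)] (hb : b ∈ maximalIdeal R) (r : R)
    (i : I) : of I b r + gen b i ∈ maximalIdeal (ReesQuotient I b) ↔ r ∈ maximalIdeal R := by
  rw [mem_maximalIdeal, mem_nonunits_iff, isUnit_iff hb, not_not]

theorem map_maximalIdeal_le [IsLocalRing (ReesQuotient I b)] (hb : b ∈ maximalIdeal R) :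
    (maximalIdeal R).map (of I b) ≤ maximalIdeal (ReesQuotient I b) :=
  Ideal.map_le_iff_le_comap.mpr fun r hr => by
    rw [Ideal.mem_comap, ← add_zero (of I b r), ← gen_zero, mem_maximalIdeal_iff hb]
    exact hr

/-- A nonzero element divides its norm, a nonzero element of R, whose radical in R contains 𝔪; the
elements jα follow because their squares bj² lie in 𝔪. -/
theorem ringKrullDim_eq_one [IsDomain R] [IsLocalRing (ReesQuotient I b)] [IsDomain (ReesQuotient I b)]
    (hdim : ringKrullDim R = 1) (hb : b ∈ maximalIdeal R) (hb0 : b ≠ 0) :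
    ringKrullDim (ReesQuotient I b) = 1 := by
  obtain ⟨-, hrad⟩ := ringKrullDim_eq_one_iff_of_isLocalRing_isDomain.mp hdim
  refine ringKrullDim_eq_one_iff_of_isLocalRing_isDomain.mpr ⟨fun hf => ?_, fun z hz => ?_⟩
  · have hb' : of I b b ≠ 0 := fun h => hb0 (of_add_gen_injective (b := b) (i := 0) (j := (0 : I))
      (by rw [map_zero, h])).1
    obtain ⟨y, hy⟩ := hf.mul_inv_cancel hb'
    have hu := IsUnit.of_mul_eq_one y hy
    rw [← add_zero (of I b b), ← gen_zero, isUnit_iff hb] at hu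
    exact hu hb
  · obtain ⟨r, i, rfl⟩ := exists_eq_of_add_gen z
    have hconj : of I b r + gen b (-i) ≠ 0 := fun h => hz (by
      obtain ⟨h1, h2⟩ := of_add_gen_injective (b := b) (s := 0) (j := (0 : I))
        (h.trans (by rw [map_zero, gen_zero, add_zero]))
      rw [h1, neg_eq_zero.mp h2, map_zero, gen_zero, add_zero])
    have hN : r ^ 2 - b * (i : R) ^ 2 ≠ 0 := fun h => mul_ne_zero hz hconj (by
      rw [mul_conj, h, map_zero])
    have hof : ∀ s ∈ maximalIdeal R,
        of I b s ∈ (Ideal.span {of I b r + gen b i}).radical := by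
      intro s hs
      obtain ⟨k, hk⟩ := hrad _ hN hs
      obtain ⟨c, hc⟩ := Ideal.mem_span_singleton.mp hk
      refine ⟨k, Ideal.mem_span_singleton.mpr ⟨(of I b r + gen b (-i)) * of I b c, ?_⟩⟩
      rw [← map_pow, hc, map_mul, ← mul_conj, mul_assoc]
    intro y hy
    obtain ⟨s, j, rfl⟩ := exists_eq_of_add_gen y
    refine add_mem (hof s ((mem_maximalIdeal_iff hb s j).mp hy)) ?_
    refine Ideal.mem_radical_of_pow_mem (m := 2) ?_
    have : gen b j ^ 2 = of I b (b * (j * j)) := map_injective I b (by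
      rw [pow_two (gen b j), map_mul, map_gen, map_of, QuadraticExtension.elt_mul]; simp)
    rw [this]
    exact hof _ (Ideal.mul_mem_right _ _ hb)

theorem of_mem_pow [IsLocalRing (ReesQuotient I b)] (hb : b ∈ maximalIdeal R) {n : ℕ} {r : R}
    (hr : r ∈ maximalIdeal R ^ n) : of I b r ∈ maximalIdeal (ReesQuotient I b) ^ n := by
  refine Ideal.pow_right_mono (map_maximalIdeal_le hb) n ?_
  rw [← Ideal.map_pow]
  exact Ideal.mem_map_of_mem _ hr

/-- By the Artin-Rees lemma, the `R`-submodule `I t` of `R[It] / ((t² - b) ∩ R[It])` carries the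
adic topology of `R`. -/
theorem exists_gen_mem_pow [IsNoetherianRing R] [IsLocalRing (ReesQuotient I b)]
    (hb : b ∈ maximalIdeal R) (n : ℕ) : ∃ k, ∀ i : I, (i : R) ∈ maximalIdeal R ^ k →
      gen b i ∈ maximalIdeal (ReesQuotient I b) ^ n := by
  obtain ⟨c, hc⟩ := (maximalIdeal R).exists_pow_inf_eq_pow_smul I
  refine ⟨n + c, fun i hi => ?_⟩
  have hmem : (i : R) ∈ maximalIdeal R ^ n • I := by
    have h := hc (n + c) (by omega)
    rw [Nat.add_sub_cancel] at h
    have h2 : (i : R) ∈ maximalIdeal R ^ (n + c) • (⊤ : Submodule R R) ⊓ I :=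
      ⟨by simpa using hi, i.2⟩
    rw [h] at h2
    exact (smul_mono_right (maximalIdeal R ^ n) inf_le_right :
      _ ≤ maximalIdeal R ^ n • I) h2
  have key : ∀ x ∈ maximalIdeal R ^ n • I, ∃ hx : x ∈ I,
      gen b ⟨x, hx⟩ ∈ maximalIdeal (ReesQuotient I b) ^ n := by
    intro x hx
    refine Submodule.smul_induction_on hx (fun r hr y hy => ?_) ?_
    · refine ⟨I.mul_mem_left _ hy, ?_⟩
      have := gen_smul (b := b) r ⟨y, hy⟩
      rw [show (⟨r • y, I.mul_mem_left _ hy⟩ : I) = r • ⟨y, hy⟩ from rfl, this]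
      exact Ideal.mul_mem_right _ _ (of_mem_pow hb hr)
    · rintro x y ⟨hx, hx'⟩ ⟨hy, hy'⟩
      refine ⟨add_mem hx hy, ?_⟩
      have := gen_add (b := b) (⟨x, hx⟩ : I) ⟨y, hy⟩
      rw [show (⟨x + y, add_mem hx hy⟩ : I) = ⟨x, hx⟩ + ⟨y, hy⟩ from rfl, this]
      exact add_mem hx' hy'
  exact (key i hmem).2

end Local

end ReesQuotient

/-! ### The valuation on R + Iα and the transfer of properties from R -/

theorem WithTop.int_two_nsmul_nonneg {x : WithTop ℤ} : 0 ≤ 2 • x ↔ 0 ≤ x := by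
  rw [two_nsmul]
  induction x using WithTop.recTopCoe with
  | top => simp
  | coe n => norm_cast; omega

theorem WithTop.int_one_le_two_nsmul {x : WithTop ℤ} (hx : 1 ≤ x) : 1 ≤ 2 • x := by
  rw [two_nsmul]
  exact hx.trans (le_add_of_nonneg_left (zero_le_one.trans hx))

theorem WithTop.int_one_le_two_nsmul_add_odd {m : ℤ} (hm : Odd m) {x : WithTop ℤ}
    (hx : 0 ≤ 2 • x + (m : WithTop ℤ)) : 1 ≤ 2 • x + (m : WithTop ℤ) := by
  obtain ⟨k, rfl⟩ := hm
  rw [two_nsmul] at *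
  induction x using WithTop.recTopCoe with
  | top => simp
  | coe n => norm_cast at *; omega

namespace ReesQuotient

open QuadraticExtension

variable {R : Type*} [CommRing R] {I : Ideal R} {b : R}

theorem isIntegral_of_isIntegral (I : Ideal R) {x : FractionRing R} (hx : IsIntegral R x) :
    IsIntegral (ReesQuotient I b) (algebraMap _ (QuadraticExtension b) x) :=
  hx.map_of_comp_eq (of I b) (algebraMap _ (QuadraticExtension b)) (RingHom.ext fun r => by
    change reesQuotientToQuadraticExtension I b (of I b r) = _
    rw [map_of]
    simp [elt])

variable [IsDomain R] (v : AddValuation (FractionRing R) (WithTop ℤ)) {m : ℤ}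
  (hb : v (algebraMap R (FractionRing R) b) = (m : WithTop ℤ)) (hm : Odd m)

theorem valuation_of_add_gen (r : R) (i : I) :
    valuation v hb hm (reesQuotientToQuadraticExtension I b (of I b r + gen b i)) =
      min (2 • v (algebraMap R _ r)) (2 • v (algebraMap R _ (i : R)) + (m : WithTop ℤ)) := by
  rw [map_of_add_gen, valuation_elt]

theorem valuation_nonneg (hR : ∀ r : R, 0 ≤ v (algebraMap R _ r)) (z : ReesQuotient I b) :
    0 ≤ valuation v hb hm (reesQuotientToQuadraticExtension I b z) := by
  obtain ⟨r, i, rfl⟩ := exists_eq_of_add_gen z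
  rw [valuation_of_add_gen, ← hb]
  exact le_min (nsmul_nonneg (hR _) 2) (add_nonneg (nsmul_nonneg (hR _) 2) (hR _))

theorem isNormalizedValuationOf_valuation (hv : IsNormalizedValuationOf R v) (I : Ideal R) :
    IsNormalizedValuationOf (ReesQuotient I b) (valuation v hb hm) := by
  have hR : ∀ r : R, 0 ≤ v (algebraMap R _ r) := fun r => (hv.1 _).mpr isIntegral_algebraMap
  have hfact : Fact (Irreducible (X ^ 2 - C (algebraMap R (FractionRing R) b))) :=
    ⟨irreducible_X_sq_sub_C v hb hm⟩
  refine ⟨fun z => ⟨fun hz => ?_, fun hz => ?_⟩, ?_⟩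
  · obtain ⟨x, y, rfl⟩ := exists_eq_elt z
    rw [valuation_elt, le_min_iff, WithTop.int_two_nsmul_nonneg] at hz
    refine IsIntegral.add (isIntegral_of_isIntegral I ((hv.1 x).mp hz.1)) ?_
    -- The square of yα is y²b, an element of Q(R) of value 2v(y) + m ≥ 0.
    refine IsIntegral.of_pow two_pos ?_
    have : (algebraMap _ (QuadraticExtension b) y * AdjoinRoot.root _) ^ 2 =
        algebraMap _ (QuadraticExtension b) (y ^ 2 * algebraMap R _ b) := by
      rw [map_mul, map_pow, ← root_mul_root]; ring
    rw [this]
    refine isIntegral_of_isIntegral I ((hv.1 _).mp ?_)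
    rw [v.map_mul, v.map_pow, hb]
    exact hz.2
  · exact AddValuation.nonneg_of_isIntegral (A := ReesQuotient I b) _
      (valuation_nonneg v hb hm hR) hz
  · obtain ⟨p, hp⟩ := hv.2
    have hm0 : 0 ≤ m := by
      have := hR b
      rw [hb] at this
      exact_mod_cast this
    obtain ⟨k, hk⟩ := id hm
    have hp0 : p ^ k.toNat ≠ 0 :=
      pow_ne_zero _ (v.ne_top_iff.mp (by rw [hp]; exact WithTop.one_ne_top))
    -- With v(p) = 1 and m = 2k + 1, the element p^(-k)α has value -2k + m = 1.
    refine ⟨elt b 0 (p ^ k.toNat)⁻¹, ?_⟩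
    rw [valuation_elt, v.map_zero]
    have h := v.add_inv_eq_zero hp0
    rw [v.map_pow, hp] at h
    have ht := v.ne_top_iff.mpr (inv_ne_zero hp0)
    rw [two_nsmul, two_nsmul, top_add, min_eq_right le_top]
    lift v (p ^ k.toNat)⁻¹ to ℤ using ht with c
    rw [nsmul_one] at h
    norm_cast at *
    have : (k.toNat : ℤ) + c = 0 := by exact_mod_cast h
    omega

theorem valueSet_valuation :
    valueSet (valuation v hb hm) (Set.range (reesQuotientToQuadraticExtension I b)) =
      numericalDuplication (valueSet v (Set.range (algebraMap R (FractionRing R))))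
        (valueSet v (algebraMap R (FractionRing R) '' (I : Set R))) m := by
  ext n
  constructor
  · rintro ⟨_, ⟨z, rfl⟩, hz⟩
    obtain ⟨r, i, rfl⟩ := exists_eq_of_add_gen z
    rw [valuation_of_add_gen] at hz
    rcases min_choice (2 • v (algebraMap R _ r))
      (2 • v (algebraMap R _ (i : R)) + (m : WithTop ℤ)) with h | h
    · rw [h, two_nsmul] at hz
      have ht : v (algebraMap R _ r) ≠ ⊤ := fun ht => by rw [ht] at hz; simp at hz
      obtain ⟨k, hk⟩ := WithTop.ne_top_iff_exists.mp ht
      refine Or.inl ⟨k, ⟨_, ⟨r, rfl⟩, hk.symm⟩, ?_⟩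
      rw [← hk] at hz
      norm_cast at hz
      change 2 * k = n
      omega
    · rw [h, two_nsmul] at hz
      have ht : v (algebraMap R _ (i : R)) ≠ ⊤ := fun ht => by rw [ht] at hz; simp at hz
      obtain ⟨k, hk⟩ := WithTop.ne_top_iff_exists.mp ht
      refine Or.inr ⟨k, ⟨_, ⟨i, i.2, rfl⟩, hk.symm⟩, ?_⟩
      rw [← hk] at hz
      norm_cast at hz
      change 2 * k + m = n
      omega
  · rintro (⟨k, ⟨_, ⟨r, rfl⟩, hk⟩, rfl⟩ | ⟨k, ⟨_, ⟨i, hi, rfl⟩, hk⟩, rfl⟩)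
    · refine ⟨_, ⟨of I b r, rfl⟩, ?_⟩
      rw [map_of, valuation_elt, hk, v.map_zero, two_nsmul, two_nsmul, top_add, top_add,
        min_eq_left le_top]
      norm_cast
      change k + k = 2 * k
      omega
    · refine ⟨_, ⟨gen b ⟨i, hi⟩, rfl⟩, ?_⟩
      rw [map_gen, valuation_elt, hk, v.map_zero, two_nsmul, two_nsmul, top_add,
        min_eq_right le_top]
      norm_cast
      change k + k + m = 2 * k + m
      omega

/-- Multiplying a common denominator of x and y by a nonzero i ∈ I puts the α-coordinate of the
numerator in I. -/
theorem isFractionRing {I : Ideal R} (hI : I ≠ ⊥)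
    (hirr : Irreducible (X ^ 2 - C (algebraMap R (FractionRing R) b))) :
    IsFractionRing (ReesQuotient I b) (QuadraticExtension b) := by
  have hfact := Fact.mk hirr
  have hfaith : FaithfulSMul (ReesQuotient I b) (QuadraticExtension b) :=
    (faithfulSMul_iff_algebraMap_injective _ _).mpr (map_injective I b)
  obtain ⟨i, hi, hi0⟩ := Submodule.exists_mem_ne_zero_of_ne_bot hI
  refine IsFractionRing.of_field _ _ fun z => ?_
  obtain ⟨x, y, rfl⟩ := exists_eq_elt z
  obtain ⟨p, d, hd, rfl⟩ := IsFractionRing.div_surjective R x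
  obtain ⟨q, e, he, rfl⟩ := IsFractionRing.div_surjective R y
  have hinj := IsFractionRing.injective R (FractionRing R)
  have hd' : algebraMap R (FractionRing R) d ≠ 0 :=
    (map_ne_zero_iff _ hinj).mpr (nonZeroDivisors.ne_zero hd)
  have he' : algebraMap R (FractionRing R) e ≠ 0 :=
    (map_ne_zero_iff _ hinj).mpr (nonZeroDivisors.ne_zero he)
  have hi' : algebraMap R (FractionRing R) i ≠ 0 := (map_ne_zero_iff _ hinj).mpr hi0
  refine ⟨of I b (p * e * i) + gen b ⟨q * d * i, I.mul_mem_left _ hi⟩, of I b (d * e * i), ?_⟩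
  change _ = reesQuotientToQuadraticExtension I b _ / reesQuotientToQuadraticExtension I b _
  have hne : reesQuotientToQuadraticExtension I b (of I b (d * e * i)) ≠ 0 := by
    rw [map_of, elt, map_zero, zero_mul, add_zero]
    refine (map_ne_zero (algebraMap (FractionRing R) (QuadraticExtension b))).mpr ?_
    rw [map_mul, map_mul]
    exact mul_ne_zero (mul_ne_zero hd' he') hi'
  rw [eq_div_iff hne, map_of_add_gen, map_of, elt_mul]
  congr 1
  · simp only [map_mul]; field_simp; simp
  · simp only [map_mul]; field_simp; simp

section Local

variable [IsLocalRing R] [IsLocalRing (ReesQuotient I b)]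

theorem one_le_valuation (hbm : b ∈ maximalIdeal R) (hR : ∀ r : R, 0 ≤ v (algebraMap R _ r))
    (h1 : ∀ r ∈ maximalIdeal R, 1 ≤ v (algebraMap R _ r)) {z : ReesQuotient I b}
    (hz : z ∈ maximalIdeal (ReesQuotient I b)) :
    1 ≤ valuation v hb hm (reesQuotientToQuadraticExtension I b z) := by
  obtain ⟨r, i, rfl⟩ := exists_eq_of_add_gen z
  rw [mem_maximalIdeal_iff hbm] at hz
  rw [valuation_of_add_gen]
  refine le_min (WithTop.int_one_le_two_nsmul (h1 r hz)) ?_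
  rw [← hb]
  exact (h1 b hbm).trans (le_add_of_nonneg_left (nsmul_nonneg (hR _) 2))

theorem isAnalyticallyIrreducible [IsNoetherianRing R] (hdim : ringKrullDim R = 1)
    (hirr : IsAnalyticallyIrreducible R) (hbm : b ∈ maximalIdeal R)
    (hR : ∀ r : R, 0 ≤ v (algebraMap R _ r))
    (h1 : ∀ r ∈ maximalIdeal R, 1 ≤ v (algebraMap R _ r))
    (hb : v (algebraMap R (FractionRing R) b) = (m : WithTop ℤ)) (hm : Odd m) :
    IsAnalyticallyIrreducible (ReesQuotient I b) := by
  refine .of_addValuation ((valuation v hb hm).comap (reesQuotientToQuadraticExtension I b))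
    (valuation_nonneg v hb hm hR) (fun z hz => one_le_valuation v hb hm hbm hR h1 hz) fun n => ?_
  obtain ⟨c, hc⟩ := exists_gen_mem_pow (I := I) hbm n
  have hinj := IsFractionRing.injective R (FractionRing R)
  obtain ⟨k, hk⟩ := hirr.exists_forall_mem_pow hdim (v.comap (algebraMap R (FractionRing R)))
    hR h1 (fun r hr => (map_eq_zero_iff _ hinj).mp (v.top_iff.mp hr)) (max n c)
  -- This bound forces both v(r) ≥ k and v(i) ≥ k, because 0 and m are at most `m.toNat`.
  refine ⟨2 * k + m.toNat, fun z hz => ?_⟩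
  obtain ⟨r, i, rfl⟩ := exists_eq_of_add_gen z
  have hz' := (valuation_of_add_gen v hb hm r i) ▸ hz
  rw [le_min_iff] at hz'
  have hr : ((k : ℤ) : WithTop ℤ) ≤ v (algebraMap R _ r) := by
    have := hz'.1
    rw [two_nsmul] at this
    generalize v (algebraMap R _ r) = x at this ⊢
    induction x using WithTop.recTopCoe with
    | top => exact le_top
    | coe t => norm_cast at *; omega
  have hi : ((k : ℤ) : WithTop ℤ) ≤ v (algebraMap R _ (i : R)) := by
    have := hz'.2
    rw [two_nsmul] at this
    generalize v (algebraMap R _ (i : R)) = x at this ⊢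
    induction x using WithTop.recTopCoe with
    | top => exact le_top
    | coe t => norm_cast at *; omega
  exact add_mem (of_mem_pow hbm (Ideal.pow_le_pow_right (le_max_left n c) (hk r hr)))
    (hc i (Ideal.pow_le_pow_right (le_max_right n c) (hk i hi)))

/-- For x + yα integral, the value 2v(y) + m of yα is nonnegative and odd or infinite, hence
positive. Only the residue of x remains, and R represents it. -/
theorem isResiduallyRational [IsDomain (ReesQuotient I b)] (hv : IsNormalizedValuationOf R v)
    (hrat : IsResiduallyRational R) (hbm : b ∈ maximalIdeal R)
    (hb : v (algebraMap R (FractionRing R) b) = (m : WithTop ℤ)) (hm : Odd m) :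
    IsResiduallyRational (ReesQuotient I b) := by
  have hfact : Fact (Irreducible (X ^ 2 - C (algebraMap R (FractionRing R) b))) :=
    ⟨irreducible_X_sq_sub_C v hb hm⟩
  refine .of_addValuation (F := QuadraticExtension b) (map_injective I b)
    (isNormalizedValuationOf_valuation v hb hm hv I).1
    (fun z hz => one_le_valuation v hb hm hbm (fun r => (hv.1 _).mpr isIntegral_algebraMap)
      (fun r hr => hrat.one_le_of_mem_maximalIdeal hv.1 hr) hz) fun z hz => ?_
  obtain ⟨x, y, rfl⟩ := exists_eq_elt z
  rw [valuation_elt, le_min_iff, WithTop.int_two_nsmul_nonneg] at hz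
  obtain ⟨a, ha⟩ := hrat.exists_one_le_sub hv.1 hz.1
  refine ⟨of I b a, ?_⟩
  have : elt b x y - algebraMap (ReesQuotient I b) (QuadraticExtension b) (of I b a) =
      elt b (x - algebraMap R _ a) y := by
    change _ - reesQuotientToQuadraticExtension I b (of I b a) = _
    rw [map_of, sub_eq_iff_eq_add, elt_add, sub_add_cancel, add_zero]
  rw [this, valuation_elt]
  exact le_min (WithTop.int_one_le_two_nsmul ha) (WithTop.int_one_le_two_nsmul_add_odd hm hz.2)

end Local

end ReesQuotient
-- The main theorem
theorem mainTheorem3 {R : Type*} [CommRing R] [IsDomain R] [IsNoetherianRing R] [IsLocalRing R]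
    (hdim : ringKrullDim R = 1) (hchar : ringChar R ≠ 2)
    (hirr : IsAnalyticallyIrreducible R) (hrat : IsResiduallyRational R)
    (v : AddValuation (FractionRing R) (WithTop ℤ)) (hv : IsNormalizedValuationOf R v)
    (I : Ideal R) (b : R) (m : ℤ)
    (hb : v (algebraMap R (FractionRing R) b) = (m : WithTop ℤ)) (hm : Odd m) :
    (IsNoetherianRing (ReesQuotient I b) ∧
      IsDomain (ReesQuotient I b) ∧
      ringKrullDim (ReesQuotient I b) = 1 ∧
      ∃ _ : IsLocalRing (ReesQuotient I b),
        IsAnalyticallyIrreducible (ReesQuotient I b) ∧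
        IsResiduallyRational (ReesQuotient I b)) ∧
    IsField (QuadraticExtension b) ∧
    Function.Injective (reesQuotientToQuadraticExtension I b) ∧
    (I ≠ ⊥ → IsFractionRing (ReesQuotient I b) (QuadraticExtension b)) ∧
    (∃ v' : AddValuation (QuadraticExtension b) (WithTop ℤ),
      IsNormalizedValuationOf (ReesQuotient I b) v') ∧
    (∀ v' : AddValuation (QuadraticExtension b) (WithTop ℤ),
      IsNormalizedValuationOf (ReesQuotient I b) v' →
        (∀ x : FractionRing R,
          v' (algebraMap (FractionRing R) (QuadraticExtension b) x) = 2 • v x) ∧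
        v' (AdjoinRoot.root _) = (m : WithTop ℤ) ∧
        valueSet v' (Set.range (reesQuotientToQuadraticExtension I b)) =
          numericalDuplication
            (valueSet v (Set.range (algebraMap R (FractionRing R))))
            (valueSet v (algebraMap R (FractionRing R) '' (I : Set R))) m) := by
  have hR : ∀ r : R, 0 ≤ v (algebraMap R _ r) := fun r => (hv.1 _).mpr isIntegral_algebraMap
  have h1 : ∀ r ∈ maximalIdeal R, 1 ≤ v (algebraMap R _ r) := fun r hr =>
    hrat.one_le_of_mem_maximalIdeal hv.1 hr
  have hb0 : b ≠ 0 := by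
    rintro rfl
    rw [map_zero, v.map_zero] at hb
    exact WithTop.top_ne_coe hb
  -- A unit has value 0, which is even.
  have hbm : b ∈ maximalIdeal R := by
    rw [mem_maximalIdeal, mem_nonunits_iff]
    rintro ⟨u, rfl⟩
    have h2 : v (algebraMap R _ (u : R)) + v (algebraMap R _ ((u⁻¹ : Rˣ) : R)) = 0 := by
      rw [← v.map_mul, ← map_mul, Units.mul_inv, map_one, v.map_one]
    have h3 : v (algebraMap R _ (u : R)) ≤ 0 := h2 ▸ le_add_of_nonneg_right (hR _)
    have h4 := le_antisymm h3 (hR _)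
    rw [hb] at h4
    have h5 : m = 0 := by exact_mod_cast h4
    rw [h5] at hm
    exact absurd hm (by decide)
  have hirred := QuadraticExtension.irreducible_X_sq_sub_C v hb hm
  have hfact := Fact.mk hirred
  have hdom : IsDomain (ReesQuotient I b) := (ReesQuotient.map_injective I b).isDomain
  have hloc : IsLocalRing (ReesQuotient I b) := ReesQuotient.isLocalRing I hbm
  have hnorm := ReesQuotient.isNormalizedValuationOf_valuation v hb hm hv I
  refine ⟨⟨ReesQuotient.isNoetherianRing I b, hdom, ReesQuotient.ringKrullDim_eq_one hdim hbm hb0,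
    hloc, ReesQuotient.isAnalyticallyIrreducible v hdim hirr hbm hR h1 hb hm,
    ReesQuotient.isResiduallyRational v hv hrat hbm hb hm⟩, Field.toIsField _,
    ReesQuotient.map_injective I b, fun hI => ReesQuotient.isFractionRing hI hirred,
    ⟨_, hnorm⟩, fun v' hv' => ?_⟩
  obtain rfl : v' = QuadraticExtension.valuation v hb hm :=
    AddValuation.eq_of_nonneg_iff (fun x => (hv'.1 x).trans (hnorm.1 x).symm) hv'.2 hnorm.2
  refine ⟨fun x => ?_, ?_, ReesQuotient.valueSet_valuation v hb hm⟩
  · rw [show algebraMap (FractionRing R) (QuadraticExtension b) x =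
      QuadraticExtension.elt b x 0 by simp [QuadraticExtension.elt],
      QuadraticExtension.valuation_elt, v.map_zero, two_nsmul ⊤, top_add, top_add,
      min_eq_left le_top]
  · rw [show AdjoinRoot.root _ = QuadraticExtension.elt b 0 1 by simp [QuadraticExtension.elt],
      QuadraticExtension.valuation_elt, v.map_zero, v.map_one, two_nsmul ⊤, top_add, smul_zero,
      zero_add, min_eq_right le_top]
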